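/- **Lemma (Simplex existence).** Let $n\ge 1$ be an integer, let $R>0$ be real, let \[ K=\Bigl\{x\in\mathbb R^n : x_i\ge 0\ (0\le i\le n-1),\ \sum_{i=0}^{n-1}x_i\le R\Bigr\}, \] and let $F=(F_0,\dots,F_{n-1}):K\to\mathbb R^n$ be continuous. Suppose that for each $0\le i\le n-1$, \[ F_i(x)<0\quad\text{whenever } x\in K \text{ and } x_i=0, \] and that \[ \sum_{i=0}^{n-1}F_i(x)>0\quad\text{whenever } x\in K \text{ and } \sum_{i=0}^{n-1}x_i=R. \] Then $F$ has a zero in the interior of $K$, that is, there exists $x\in K$ such that \[ F(x)=0,\qquad x_i>0\ (0\le i\le n-1),\qquad \sum_{i=0}^{n-1}x_i<R. \] -/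

import Mathlib

/-- The solid simplex `{x ∈ ℝⁿ : x ≥ 0, ∑ i, x i ≤ R}`. -/
def solidSimplex (n : ℕ) (R : ℝ) : Set (Fin n → ℝ) :=
  {x | (∀ i, 0 ≤ x i) ∧ ∑ i, x i ≤ R}

/-!
In the barycentric coordinates of the simplex, with the extra coordinate `R - ∑ i, x i` and the
extra component `-∑ i, F i`, the map becomes a family `G` of functions with `∑ o, G o = 0` and
`G o < 0` on the face where the `o`-th coordinate vanishes. At every point some `G o` is
nonpositive, so the closed sets `{G o ≤ 0}` cover the simplex. By a covering theorem of
Knaster-Kuratowski-Mazurkiewicz type (`exists_mem_of_closed_cover`) some point lies in `{G o ≤ 0}`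
for every `o` in its support. For the other `o` the boundary condition gives `G o < 0`, so all
`G o` are nonpositive there; as they sum to zero they all vanish, and the strict boundary
conditions keep the point in the interior.

The covering theorem follows by compactness from a colouring statement for the integer points of a
dilated simplex (`exists_close_rainbow`), which plays the role of Sperner's lemma. It is derived
from Scarf's lemma (`exists_dominant_rainbow`), which needs no triangulation: the cells are the
finite sets that are dominant for the orders given by the coordinates. One extra point per
coordinate, called a ghost, stands for the corresponding face. The proof of Scarf's lemma is the
parity argument familiar from Sperner's lemma. A facet whose points show all colours but a fixed
one lies in an even number of full cells (`even_card_fullAbove`), except for the facet made of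
ghosts, which lies in exactly one (`card_fullAbove_ghosts`); a full cell that misses a colour has an
even number of such facets (`even_card_facets`). So some full cell misses no colour.
-/

/-! ### Dominant sets for a family of orders -/

/-- Each index `i` orders `X` by the values of `r i`. A finite set `S` is dominant if no point of `X`
lies strictly above the `i`-minimum of `S` for every `i` at once. -/
def Dominant {X I : Type*} (r : I → X → ℤ) (S : Finset X) : Prop :=
  ∀ y, ∃ i, ∀ x ∈ S, r i y ≤ r i x

/-- `m i` is the `i`-minimum of `S` for every index `i`. -/
def IsMinMap {X I : Type*} (r : I → X → ℤ) (S : Finset X) (m : I → X) : Prop :=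
  ∀ i, m i ∈ S ∧ ∀ x ∈ S, r i (m i) ≤ r i x

/-- `x` is the `k`-largest among the points lying strictly `l`-above `m l` for every `l ≠ k`. -/
def IsSummit {X I : Type*} (r : I → X → ℤ) (m : I → X) (k : I) (x : X) : Prop :=
  (∀ l, l ≠ k → r l (m l) < r l x) ∧
    ∀ z, (∀ l, l ≠ k → r l (m l) < r l z) → r k z ≤ r k x

section Dominance

variable {X I : Type*} {r : I → X → ℤ} {S τ : Finset X} {m : I → X}

theorem Dominant.mono (h : Dominant r S) (hτ : τ ⊆ S) : Dominant r τ := fun y => by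
  obtain ⟨i, hi⟩ := h y
  exact ⟨i, fun x hx => hi x (hτ hx)⟩

theorem exists_isMinMap (r : I → X → ℤ) (hS : S.Nonempty) : ∃ m, IsMinMap r S m := by
  choose m hm using fun i => Finset.exists_min_image S (r i) hS
  exact ⟨m, hm⟩

/-- Every point of a dominant set is its minimum for some index. -/
theorem Dominant.exists_min_eq (hr : ∀ i, Function.Injective (r i)) (h : Dominant r S)
    (hm : IsMinMap r S m) {x : X} (hx : x ∈ S) : ∃ i, m i = x := by
  obtain ⟨i, hi⟩ := h x
  exact ⟨i, hr i (le_antisymm ((hm i).2 x hx) (hi _ (hm i).1))⟩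

theorem IsSummit.eq (hr : ∀ i, Function.Injective (r i)) {k : I} {x y : X}
    (hx : IsSummit r m k x) (hy : IsSummit r m k y) : x = y :=
  hr k (le_antisymm (hy.2 x hx.1) (hx.2 y hy.1))

theorem exists_isSummit [Fintype X] {k : I} {z : X} (hz : ∀ l, l ≠ k → r l (m l) < r l z) :
    ∃ x, IsSummit r m k x := by
  classical
  obtain ⟨x, hx, hmax⟩ := Finset.exists_max_image
    (Finset.univ.filter fun z => ∀ l, l ≠ k → r l (m l) < r l z) (r k) ⟨z, by simpa using hz⟩
  exact ⟨x, by simpa using hx, fun w hw => hmax w (by simpa using hw)⟩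

/-- If a set has one point fewer than there are indices, two indices share their minimum. -/
theorem IsMinMap.exists_ne_eq [Fintype I] (hm : IsMinMap r τ m)
    (hcard : τ.card + 1 = Fintype.card I) : ∃ i j, i ≠ j ∧ m i = m j := by
  classical
  obtain ⟨i, -, j, -, hij, h⟩ := Finset.exists_ne_map_eq_of_card_lt_of_maps_to
    (s := Finset.univ) (t := τ) (f := m) (by rw [Finset.card_univ]; omega)
    (fun i _ => (hm i).1)
  exact ⟨i, j, hij, h⟩

theorem Dominant.not_isSummit_both (h : Dominant r τ) (hm : IsMinMap r τ m) {i j : I}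
    (hij : i ≠ j) {x : X} (hi : IsSummit r m i x) (hj : IsSummit r m j x) : False := by
  obtain ⟨l, hl⟩ := h x
  have hle := hl _ (hm l).1
  by_cases hli : l = i
  · exact (hj.1 l (hli ▸ hij)).not_ge hle
  · exact (hi.1 l hli).not_ge hle

variable [DecidableEq X]

/-- If the indices `i` and `j` share their minimum in `τ`, a point that extends `τ` to a dominant
set with as many points as there are indices is a summit for `i` or for `j`: the index whose minimum
is the new point has to separate `i` from `j`. -/
theorem Dominant.isSummit_of_insert [Fintype I] (hr : ∀ i, Function.Injective (r i))
    (hm : IsMinMap r τ m) (hcard : τ.card + 1 = Fintype.card I)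
    {i j : I} (hij : i ≠ j) (hmij : m i = m j) {x : X} (hx : x ∉ τ)
    (h : Dominant r (insert x τ)) : IsSummit r m i x ∨ IsSummit r m j x := by
  classical
  obtain ⟨m', hm'⟩ := exists_isMinMap r (Finset.insert_nonempty x τ)
  have hinj : Function.Injective m' := by
    have himg : Finset.univ.image m' = insert x τ := by
      ext y
      simp only [Finset.mem_image, Finset.mem_univ, true_and]
      exact ⟨fun ⟨l, hl⟩ => hl ▸ (hm' l).1, fun hy => h.exists_min_eq hr hm' hy⟩
    refine Set.injOn_univ.1 (Finset.coe_univ (α := I) ▸ Finset.injOn_of_card_image_eq ?_)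
    rw [himg, Finset.card_insert_of_notMem hx, hcard, Finset.card_univ]
  obtain ⟨k, hk⟩ := h.exists_min_eq hr hm' (Finset.mem_insert_self x τ)
  have hmem : ∀ l, l ≠ k → m' l ∈ τ := fun l hl =>
    Finset.mem_of_mem_insert_of_ne (hm' l).1 fun e => hl (hinj (e.trans hk.symm))
  have heq : ∀ l, l ≠ k → m' l = m l := fun l hl =>
    hr l (le_antisymm ((hm' l).2 _ (Finset.mem_insert_of_mem (hm l).1)) ((hm l).2 _ (hmem l hl)))
  have hsummit : IsSummit r m k x := by
    refine ⟨fun l hl => ?_, fun z hz => ?_⟩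
    · rw [← heq l hl]
      refine lt_of_le_of_ne ((hm' l).2 x (Finset.mem_insert_self x τ)) fun e => hx ?_
      rw [← hr l e]
      exact hmem l hl
    · obtain ⟨l, hl⟩ := h z
      by_cases hlk : l = k
      · exact hlk ▸ hl x (Finset.mem_insert_self x τ)
      · exact absurd (hl _ (Finset.mem_insert_of_mem (hm l).1)) (hz l hlk).not_ge
  by_cases hik : i = k
  · exact .inl (hik ▸ hsummit)
  by_cases hjk : j = k
  · exact .inr (hjk ▸ hsummit)
  exact absurd (hinj ((heq i hik).trans (hmij.trans (heq j hjk).symm))) hij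

theorem Dominant.insert_of_isSummit (hr : ∀ i, Function.Injective (r i))
    (h : Dominant r τ) (hm : IsMinMap r τ m) {i j : I} (hij : i ≠ j) (hmij : m i = m j) {x : X}
    (hx : IsSummit r m i x) : x ∉ τ ∧ Dominant r (insert x τ) := by
  constructor
  · intro hxτ
    obtain ⟨l, hl⟩ := h.exists_min_eq hr hm hxτ
    by_cases hli : l = i
    · exact (hx.1 j hij.symm).ne (by rw [← hmij, ← hli, hl])
    · exact (hx.1 l hli).ne (by rw [hl])
  · intro z
    by_cases hz : ∀ l, l ≠ i → r l (m l) < r l z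
    · refine ⟨i, fun w hw => ?_⟩
      rcases Finset.mem_insert.1 hw with rfl | hw
      · exact hx.2 z hz
      · obtain ⟨l, hl⟩ := h x
        by_cases hli : l = i
        · exact (hx.2 z hz).trans (hli ▸ hl w hw)
        · exact absurd (hl _ (hm l).1) (hx.1 l hli).not_ge
    · push Not at hz
      obtain ⟨l, hli, hl⟩ := hz
      refine ⟨l, fun w hw => ?_⟩
      rcases Finset.mem_insert.1 hw with rfl | hw
      · exact hl.trans (hx.1 l hli).le
      · exact hl.trans ((hm l).2 w hw)

end Dominance

/-! ### Parity of the incidences between small and full dominant sets -/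

section Incidence

variable {X I : Type*} [Fintype X] [DecidableEq X] [Fintype I] {r : I → X → ℤ} {τ : Finset X}

open Classical in
/-- The dominant sets with as many points as there are indices that contain `τ`. -/
noncomputable def fullAbove (r : I → X → ℤ) (τ : Finset X) : Finset (Finset X) :=
  Finset.univ.filter fun S => (S.card = Fintype.card I ∧ Dominant r S) ∧ τ ⊆ S

theorem mem_fullAbove_iff (hcard : τ.card + 1 = Fintype.card I) {S : Finset X} :
    S ∈ fullAbove r τ ↔ ∃ x ∉ τ, S = insert x τ ∧ Dominant r (insert x τ) := by
  simp only [fullAbove, Finset.mem_filter, Finset.mem_univ, true_and]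
  constructor
  · rintro ⟨⟨hS, hd⟩, hsub⟩
    obtain ⟨x, hx, rfl⟩ := Finset.exists_eq_insert_iff.2 ⟨hsub, hcard.trans hS.symm⟩
    exact ⟨x, hx, rfl, hd⟩
  · rintro ⟨x, hx, rfl, hd⟩
    exact ⟨⟨by rw [Finset.card_insert_of_notMem hx, hcard], hd⟩, Finset.subset_insert x τ⟩

/-- A nonempty set with one point fewer than there are indices lies in exactly two full
dominant sets, or in none, as soon as each index admits a candidate for its summit. -/
theorem even_card_fullAbove (hr : ∀ i, Function.Injective (r i)) (hτ : τ.Nonempty)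
    (hcard : τ.card + 1 = Fintype.card I)
    (hex : ∀ m, IsMinMap r τ m → ∀ k, ∃ z, ∀ l, l ≠ k → r l (m l) < r l z) :
    Even (fullAbove r τ).card := by
  by_cases hd : Dominant r τ
  · obtain ⟨m, hm⟩ := exists_isMinMap r hτ
    obtain ⟨i, j, hij, hmij⟩ := IsMinMap.exists_ne_eq hm hcard
    obtain ⟨_, ha⟩ := hex m hm i
    obtain ⟨a, ha⟩ := exists_isSummit ha
    obtain ⟨_, hb⟩ := hex m hm j
    obtain ⟨b, hb⟩ := exists_isSummit hb
    obtain ⟨haτ, had⟩ := hd.insert_of_isSummit hr hm hij hmij ha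
    obtain ⟨hbτ, hbd⟩ := hd.insert_of_isSummit hr hm hij.symm hmij.symm hb
    have hab : a ≠ b := fun e => hd.not_isSummit_both hm hij ha (e ▸ hb)
    have hpair : fullAbove r τ = {insert a τ, insert b τ} := by
      ext S
      rw [mem_fullAbove_iff hcard, Finset.mem_insert, Finset.mem_singleton]
      constructor
      · rintro ⟨x, hx, rfl, hxd⟩
        rcases hxd.isSummit_of_insert hr hm hcard hij hmij hx with hs | hs
        · exact .inl (by rw [hs.eq hr ha])
        · exact .inr (by rw [hs.eq hr hb])
      · rintro (rfl | rfl)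
        · exact ⟨a, haτ, rfl, had⟩
        · exact ⟨b, hbτ, rfl, hbd⟩
    have hne : insert a τ ≠ insert b τ := fun e => by
      have : a ∈ insert b τ := e ▸ Finset.mem_insert_self a τ
      exact (Finset.mem_insert.1 this).elim hab haτ
    rw [hpair, Finset.card_pair hne]
    exact even_two
  · have hempty : fullAbove r τ = ∅ := by
      refine Finset.eq_empty_of_forall_notMem fun S hS => hd ?_
      simp only [fullAbove, Finset.mem_filter] at hS
      exact hS.2.1.2.mono hS.2.2
    rw [hempty]
    simp

end Incidence

/-- A set of the size of the palette that misses a colour has an even number (zero or two) of facets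
carrying exactly the colours other than `i₀`. -/
theorem even_card_facets {X I : Type*} [Fintype X] [DecidableEq X] [Fintype I] [DecidableEq I]
    (c : X → I) (i₀ : I) {S : Finset X} (hS : S.card = Fintype.card I)
    (hc : S.image c ≠ Finset.univ) :
    Even (Finset.univ.filter fun τ : Finset X =>
      (τ.card + 1 = Fintype.card I ∧ τ.image c = Finset.univ.erase i₀) ∧ τ ⊆ S).card := by
  set P := Finset.univ.filter fun τ : Finset X =>
      (τ.card + 1 = Fintype.card I ∧ τ.image c = Finset.univ.erase i₀) ∧ τ ⊆ S with hP
  have hmem : ∀ τ, τ ∈ P ↔ ∃ x ∈ S, S.erase x = τ ∧ (S.erase x).image c = Finset.univ.erase i₀ := by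
    intro τ
    simp only [hP, Finset.mem_filter, Finset.mem_univ, true_and]
    constructor
    · rintro ⟨⟨h1, h2⟩, h3⟩
      obtain ⟨x, hx, rfl⟩ := Finset.exists_eq_insert_iff.2 ⟨h3, h1.trans hS.symm⟩
      exact ⟨x, Finset.mem_insert_self _ _, Finset.erase_insert hx, by rwa [Finset.erase_insert hx]⟩
    · rintro ⟨x, hx, rfl, h⟩
      exact ⟨⟨by rw [Finset.card_erase_add_one hx, hS], h⟩, Finset.erase_subset _ _⟩
  rcases P.eq_empty_or_nonempty with h0 | ⟨_, hτ⟩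
  · rw [h0]
    simp
  obtain ⟨x, hx, -, himg⟩ := (hmem _).1 hτ
  have hcx : c x ≠ i₀ := by
    intro e
    apply hc
    rw [← Finset.insert_erase hx, Finset.image_insert, himg, e,
      Finset.insert_erase (Finset.mem_univ _)]
  have hinj : Set.InjOn c (S.erase x) := by
    apply Finset.injOn_of_card_image_eq
    rw [himg, Finset.card_erase_of_mem (Finset.mem_univ _), Finset.card_erase_of_mem hx, hS,
      Finset.card_univ]
  -- The second facet omits the other point of the same colour as `x`.
  obtain ⟨y, hy, hxy⟩ : ∃ y ∈ S.erase x, c y = c x :=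
    Finset.mem_image.1 (himg ▸ Finset.mem_erase.2 ⟨hcx, Finset.mem_univ _⟩)
  have hyx : y ≠ x := Finset.ne_of_mem_erase hy
  have hyS : y ∈ S := Finset.mem_of_mem_erase hy
  have himg' : (S.erase y).image c = (S.erase x).image c := by
    ext a
    simp only [Finset.mem_image, Finset.mem_erase]
    constructor
    · rintro ⟨w, ⟨hwy, hw⟩, rfl⟩
      by_cases hwx : w = x
      · exact ⟨y, ⟨hyx, hyS⟩, by rw [hxy, hwx]⟩
      · exact ⟨w, ⟨hwx, hw⟩, rfl⟩
    · rintro ⟨w, ⟨hwx, hw⟩, rfl⟩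
      by_cases hwy : w = y
      · exact ⟨x, ⟨hyx.symm, hx⟩, by rw [← hxy, hwy]⟩
      · exact ⟨w, ⟨hwy, hw⟩, rfl⟩
  have hpair : P = {S.erase x, S.erase y} := by
    ext τ
    rw [hmem, Finset.mem_insert, Finset.mem_singleton]
    constructor
    · rintro ⟨z, hz, rfl, hzimg⟩
      by_cases hzx : z = x
      · exact .inl (by rw [hzx])
      have hz' : z ∈ S.erase x := Finset.mem_erase.2 ⟨hzx, hz⟩
      obtain ⟨w, hw, hwz⟩ : ∃ w ∈ S.erase z, c w = c z := by
        rw [← Finset.mem_image, hzimg, ← himg]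
        exact Finset.mem_image_of_mem c hz'
      obtain ⟨hwz', hwS⟩ := Finset.mem_erase.1 hw
      by_cases hwx : w = x
      · exact .inr (by rw [hinj hz' hy (by rw [← hwz, hwx, hxy])])
      · exact absurd (hinj (Finset.mem_coe.2 (Finset.mem_erase.2 ⟨hwx, hwS⟩)) hz' hwz) hwz'
    · rintro (rfl | rfl)
      · exact ⟨x, hx, rfl, himg⟩
      · exact ⟨y, hyS, rfl, himg'.trans himg⟩
  have hne : S.erase x ≠ S.erase y := fun e => Finset.notMem_erase y S (e ▸ hy)
  rw [hpair, Finset.card_pair hne]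
  exact even_two

/-! ### The existence of a rainbow dominant set -/

section Scarf

variable {T I : Type*} [Fintype T] [DecidableEq T] [Fintype I] [DecidableEq I]
  {r : I → T ⊕ I → ℤ}

omit [Fintype T] [DecidableEq T] [Fintype I] [DecidableEq I] in
theorem not_dominant_of_forall_inr_mem [Nonempty T] (hr : ∀ i, Function.Injective (r i))
    (hbot : ∀ i x, r i (Sum.inr i) ≤ r i x) {S : Finset (T ⊕ I)} (hS : ∀ i, Sum.inr i ∈ S) :
    ¬ Dominant r S := by
  intro h
  obtain ⟨t⟩ := ‹Nonempty T›
  obtain ⟨i, hi⟩ := h (Sum.inl t)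
  exact Sum.inl_ne_inr (hr i (le_antisymm (hi _ (hS i)) (hbot i _)))

/-- The ghosts are the points `Sum.inr i`. The facet consisting of all ghosts but one lies in exactly
one full dominant set: the new point has to be the largest real point for the missing index. -/
theorem card_fullAbove_ghosts [Nonempty T] (hr : ∀ i, Function.Injective (r i))
    (hbot : ∀ i x, r i (Sum.inr i) ≤ r i x)
    (htop : ∀ i j t, i ≠ j → r i (Sum.inl t) < r i (Sum.inr j)) (i₀ : I) :
    (fullAbove r ((Finset.univ.erase i₀).image (Sum.inr : I → T ⊕ I))).card = 1 := by
  set τ := (Finset.univ.erase i₀).image (Sum.inr : I → T ⊕ I) with hτ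
  have hmem : ∀ i, i ≠ i₀ → (Sum.inr i : T ⊕ I) ∈ τ := fun i hi => by simp [hτ, hi]
  have hcard : τ.card + 1 = Fintype.card I := by
    rw [hτ, Finset.card_image_of_injective _ Sum.inr_injective,
      Finset.card_erase_add_one (Finset.mem_univ _), Finset.card_univ]
  obtain ⟨t, -, ht⟩ := Finset.exists_max_image (Finset.univ : Finset T)
    (fun t => r i₀ (Sum.inl t)) Finset.univ_nonempty
  rw [Finset.card_eq_one]
  refine ⟨insert (Sum.inl t) τ, ?_⟩
  ext S
  rw [mem_fullAbove_iff hcard, Finset.mem_singleton]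
  constructor
  · rintro ⟨x, hx, rfl, hd⟩
    rcases x with s | i
    · obtain ⟨i, hi⟩ := hd (Sum.inl t)
      have hii : i = i₀ := by
        by_contra hne
        exact Sum.inl_ne_inr (hr i (le_antisymm
          (hi _ (Finset.mem_insert_of_mem (hmem i hne))) (hbot i _)))
      subst hii
      rw [hr i (le_antisymm (hi _ (Finset.mem_insert_self _ _)) (ht s (Finset.mem_univ _)))]
    · refine absurd hd (not_dominant_of_forall_inr_mem hr hbot fun j => ?_)
      by_cases hj : j = i₀
      · have : i = i₀ := by
          by_contra hne
          exact hx (hmem i hne)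
        rw [hj, this]
        exact Finset.mem_insert_self _ _
      · exact Finset.mem_insert_of_mem (hmem j hj)
  · rintro rfl
    refine ⟨Sum.inl t, by simp [hτ], rfl, fun z => ?_⟩
    rcases z with s | k
    · refine ⟨i₀, fun x hx => ?_⟩
      rcases Finset.mem_insert.1 hx with rfl | hx
      · exact ht s (Finset.mem_univ _)
      · obtain ⟨j, hj, rfl⟩ := Finset.mem_image.1 hx
        exact (htop i₀ j s (Finset.ne_of_mem_erase hj).symm).le
    · exact ⟨k, fun x _ => hbot k x⟩

/-- **Scarf's lemma.** The points of `T` are coloured by `c`, and the ghost `Sum.inr i`, which is the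
smallest point for the index `i` and larger than all of `T` for the other indices, has colour `i`.
Then some dominant set carries all colours. -/
theorem exists_dominant_rainbow [Nonempty T] [Nontrivial I] (hr : ∀ i, Function.Injective (r i))
    (hbot : ∀ i x, r i (Sum.inr i) ≤ r i x)
    (htop : ∀ i j t, i ≠ j → r i (Sum.inl t) < r i (Sum.inr j)) (c : T → I) :
    ∃ S : Finset (T ⊕ I), Dominant r S ∧ ∀ i, ∃ x ∈ S, Sum.elim c id x = i := by
  classical
  by_contra hno
  obtain ⟨i₀⟩ : Nonempty I := inferInstance
  set col : T ⊕ I → I := Sum.elim c id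
  set τ₀ := (Finset.univ.erase i₀).image (Sum.inr : I → T ⊕ I) with hτ₀
  set full : Finset (Finset (T ⊕ I)) :=
    Finset.univ.filter fun S => S.card = Fintype.card I ∧ Dominant r S
  set facets : Finset (Finset (T ⊕ I)) :=
    Finset.univ.filter fun τ => τ.card + 1 = Fintype.card I ∧ τ.image col = Finset.univ.erase i₀
    with hfacets
  have hτ₀mem : τ₀ ∈ facets := by
    simp only [hfacets, Finset.mem_filter, Finset.mem_univ, true_and]
    constructor
    · rw [hτ₀, Finset.card_image_of_injective _ Sum.inr_injective,
        Finset.card_erase_add_one (Finset.mem_univ _), Finset.card_univ]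
    · rw [hτ₀, Finset.image_image]
      exact Finset.image_id
  have habove : ∀ τ, full.bipartiteAbove (· ⊆ ·) τ = fullAbove r τ := fun τ => by
    simp only [Finset.bipartiteAbove, full, fullAbove, Finset.filter_filter]
  have hcount := Finset.sum_card_bipartiteAbove_eq_sum_card_bipartiteBelow (s := facets) (t := full)
    (fun τ S : Finset (T ⊕ I) => τ ⊆ S)
  have hright : Even (∑ S ∈ full, (facets.bipartiteBelow (· ⊆ ·) S).card) := by
    refine Finset.even_sum _ fun S hS => ?_
    simp only [full, Finset.mem_filter, Finset.mem_univ, true_and] at hS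
    have := even_card_facets col i₀ hS.1 fun h => hno ⟨S, hS.2, fun i =>
      Finset.mem_image.1 (h ▸ Finset.mem_univ i)⟩
    simpa only [Finset.bipartiteBelow, facets, Finset.filter_filter] using this
  have hleft : Even (∑ τ ∈ facets.erase τ₀, (full.bipartiteAbove (· ⊆ ·) τ).card) := by
    refine Finset.even_sum _ fun τ hτ => ?_
    obtain ⟨hne, hτ⟩ := Finset.mem_erase.1 hτ
    simp only [hfacets, Finset.mem_filter, Finset.mem_univ, true_and] at hτ
    obtain ⟨hcard, himg⟩ := hτ
    rw [habove]
    have hτne : τ.Nonempty := by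
      rw [← Finset.card_pos]
      have := Fintype.one_lt_card (α := I)
      omega
    refine even_card_fullAbove hr hτne hcard fun m hm k => ?_
    -- A facet other than `τ₀` has a real point, and this makes the ghost of `k` a candidate.
    have hreal : ∃ t, Sum.inl t ∈ τ := by
      by_contra! hnot
      apply hne
      ext x
      rcases x with t | i
      · simp [hnot t, hτ₀]
      · have : i ∈ τ.image col ↔ Sum.inr i ∈ τ := by
          rw [Finset.mem_image]
          constructor
          · rintro ⟨x, hx, hxi⟩
            rcases x with t | j
            · exact absurd hx (hnot t)
            · obtain rfl : j = i := hxi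
              exact hx
          · exact fun h => ⟨_, h, rfl⟩
        rw [← this, himg, hτ₀]
        simp
    obtain ⟨t, ht⟩ := hreal
    exact ⟨Sum.inr k, fun l hl => ((hm l).2 _ ht).trans_lt (htop l k t hl)⟩
  rw [← Finset.add_sum_erase _ _ hτ₀mem, habove, card_fullAbove_ghosts hr hbot htop i₀] at hcount
  rw [← hcount, add_comm, Nat.even_add_one] at hright
  exact hright hleft

end Scarf

/-! ### Small rainbow cells in the integer grid of a simplex -/

/-- Adding a tie-breaking term below `M` to integers scaled by `M` keeps strict inequalities. -/
theorem tieBreak_lt {M : ℕ} {a b : ℤ} (u v : Fin M) (h : a < b) :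
    a * M + (u : ℕ) < b * M + (v : ℕ) := by
  have hu : ((u : ℕ) : ℤ) < M := by exact_mod_cast u.2
  have hM : (0 : ℤ) ≤ M := by positivity
  nlinarith [mul_le_mul_of_nonneg_right (show a + 1 ≤ b from h) hM]

/-- Colour the integer points `t ≥ 0` with `∑ i, t i = N`. Then some such points, pairwise close
independently of `N`, show every colour `i` except possibly those with `t i` small. -/
theorem exists_close_rainbow {I : Type*} [Fintype I] [DecidableEq I] [Nontrivial I] (N : ℕ)
    (c : (I → ℕ) → I) :
    ∃ x : I → ℕ, ∑ i, x i = N ∧ ∀ i, ∃ y : I → ℕ, ∑ j, y j = N ∧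
      (∀ l, |(x l : ℤ) - y l| ≤ Fintype.card I) ∧ (c y = i ∨ y i ≤ Fintype.card I) := by
  classical
  let T := {t : I → ℕ // t ∈ Finset.piAntidiag (Finset.univ : Finset I) N}
  have hT : ∀ t : I → ℕ, t ∈ Finset.piAntidiag (Finset.univ : Finset I) N ↔ ∑ i, t i = N :=
    fun t => by simp [Finset.mem_piAntidiag]
  have : Nonempty T := ⟨⟨Pi.single (Classical.arbitrary I) N, (hT _).2 (by simp)⟩⟩
  let M := Fintype.card (T ⊕ I)
  let e : T ⊕ I ≃ Fin M := Fintype.equivFin _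
  -- The ghost of `j` is placed outside the simplex, below the `j`-th face and above all others.
  let p : T ⊕ I → I → ℤ :=
    Sum.elim (fun t i => (t.1 i : ℤ)) (fun j i => if i = j then -1 else N + 1)
  let r : I → T ⊕ I → ℤ := fun i x => p x i * M + (e x : ℕ)
  have hlt : ∀ i x y, p x i < p y i → r i x < r i y := fun i x y h => tieBreak_lt _ _ h
  have hle : ∀ i x y, r i x ≤ r i y → p x i ≤ p y i := fun i x y h =>
    not_lt.1 fun h' => (hlt i y x h').not_ge h
  have hr : ∀ i, Function.Injective (r i) := by
    intro i x y h
    have hp : p x i = p y i := le_antisymm (hle i x y h.le) (hle i y x h.ge)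
    have h' : p x i * M + (e x : ℕ) = p y i * M + (e y : ℕ) := h
    rw [hp] at h'
    exact e.injective (Fin.ext (by exact_mod_cast add_left_cancel h'))
  have hbot : ∀ i x, r i (Sum.inr i) ≤ r i x := by
    intro i x
    rcases x with t | j
    · exact (hlt _ _ _ (by simp only [p, Sum.elim_inr, Sum.elim_inl, if_true]; omega)).le
    · by_cases hij : i = j
      · rw [hij]
      · exact (hlt _ _ _ (by simp only [p, Sum.elim_inr, if_true, if_neg hij]; omega)).le
  have htop : ∀ i j t, i ≠ j → r i (Sum.inl t) < r i (Sum.inr j) := by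
    intro i j t hij
    apply hlt
    simp only [p, Sum.elim_inr, Sum.elim_inl, if_neg hij]
    have := Finset.single_le_sum (f := t.1) (fun l _ => Nat.zero_le _) (Finset.mem_univ i)
    rw [(hT t.1).1 t.2] at this
    omega
  obtain ⟨S, hS, hcol⟩ := exists_dominant_rainbow hr hbot htop (fun t : T => c t.1)
  let σ : Finset (I → ℕ) := (Finset.piAntidiag Finset.univ N).filter fun t =>
    ∃ h : t ∈ Finset.piAntidiag (Finset.univ : Finset I) N, Sum.inl ⟨t, h⟩ ∈ S
  have hσ : ∀ t : T, Sum.inl t ∈ S → t.1 ∈ σ := fun t ht =>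
    Finset.mem_filter.2 ⟨t.2, t.2, ht⟩
  have hσsum : ∀ t ∈ σ, ∑ i, t i = N := fun t ht => (hT t).1 (Finset.mem_filter.1 ht).1
  let C : Finset I := Finset.univ.filter fun i => Sum.inr i ∉ S
  have hσC : ∀ i ∈ C, ∃ t ∈ σ, c t = i := by
    intro i hi
    obtain ⟨x, hx, hxi⟩ := hcol i
    rcases x with t | j
    · exact ⟨t.1, hσ t hx, hxi⟩
    · obtain rfl : j = i := hxi
      exact absurd hx (Finset.mem_filter.1 hi).2
  have hdom : ∀ t : I → ℕ, ∑ i, t i = N → ∃ i ∈ C, ∀ x ∈ σ, t i ≤ x i := by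
    intro t ht
    obtain ⟨i, hi⟩ := hS (Sum.inl ⟨t, (hT t).2 ht⟩)
    refine ⟨i, ?_, fun x hx => ?_⟩
    · simp only [C, Finset.mem_filter, Finset.mem_univ, true_and]
      intro hmem
      exact Sum.inl_ne_inr (hr i (le_antisymm (hi _ hmem) (hbot i _)))
    · obtain ⟨h, hx⟩ := (Finset.mem_filter.1 hx).2
      exact Int.ofNat_le.1 (hle _ _ _ (hi _ hx))
  obtain ⟨i₁, hi₁, -⟩ := hdom (Pi.single (Classical.arbitrary I) N) (by simp)
  obtain ⟨x₀, hx₀, -⟩ := hσC i₁ hi₁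
  choose w hwσ hw using fun i => Finset.exists_min_image σ (fun t => t i) ⟨x₀, hx₀⟩
  -- Otherwise a grid point would exceed the minimum of `σ` in every coordinate of `C`.
  have hsum : N < ∑ i ∈ C, (w i i + 1) := by
    by_contra! hcon
    let t : I → ℕ := fun i => (if i ∈ C then w i i + 1 else 0) +
      Pi.single (M := fun _ => ℕ) i₁ (N - ∑ i ∈ C, (w i i + 1)) i
    obtain ⟨i, hi, hti⟩ := hdom t (by
      simp only [t, Finset.sum_add_distrib, Finset.sum_ite_mem, Finset.univ_inter,
        Finset.sum_pi_single', Finset.mem_univ, if_true]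
      rw [Finset.sum_add_distrib] at hcon
      omega)
    have := hti _ (hwσ i)
    simp only [t, if_pos hi] at this
    omega
  have hCcard : C.card ≤ Fintype.card I := Finset.card_le_univ C
  rw [Finset.sum_add_distrib, Finset.sum_const, smul_eq_mul, mul_one] at hsum
  have hsplit : ∀ x ∈ σ, ∑ i ∈ C, x i + ∑ i ∈ Cᶜ, x i = N := fun x hx => by
    rw [Finset.sum_add_sum_compl, hσsum x hx]
  have hin : ∀ x ∈ σ, ∀ i ∈ C, x i ≤ w i i + Fintype.card I := by
    intro x hx i hi
    have h1 : ∑ l ∈ C.erase i, w l l ≤ ∑ l ∈ C.erase i, x l :=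
      Finset.sum_le_sum fun l _ => hw l x hx
    have h2 := Finset.add_sum_erase C (fun l => w l l) hi
    have h3 := Finset.add_sum_erase C x hi
    have h4 := hsplit x hx
    omega
  have hout : ∀ x ∈ σ, ∀ i, i ∉ C → x i ≤ Fintype.card I := by
    intro x hx i hi
    have h1 : ∑ l ∈ C, w l l ≤ ∑ l ∈ C, x l := Finset.sum_le_sum fun l _ => hw l x hx
    have h2 := Finset.single_le_sum (f := x) (fun l _ => Nat.zero_le _) (Finset.mem_compl.2 hi)
    have h4 := hsplit x hx
    omega
  have hclose : ∀ x ∈ σ, ∀ y ∈ σ, ∀ l, |(x l : ℤ) - y l| ≤ Fintype.card I := by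
    intro x hx y hy l
    rw [abs_le]
    by_cases hl : l ∈ C
    · have := hin x hx l hl
      have := hin y hy l hl
      have := hw l x hx
      have := hw l y hy
      constructor <;> omega
    · have := hout x hx l hl
      have := hout y hy l hl
      constructor <;> omega
  refine ⟨x₀, hσsum x₀ hx₀, fun i => ?_⟩
  by_cases hi : i ∈ C
  · obtain ⟨y, hy, hyi⟩ := hσC i hi
    exact ⟨y, hσsum y hy, hclose x₀ hx₀ y hy, .inl hyi⟩
  · exact ⟨x₀, hσsum x₀ hx₀, hclose x₀ hx₀ x₀ hx₀, .inr (hout x₀ hx₀ i hi)⟩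

/-! ### Closed covers of the simplex -/

open Filter Topology in
/-- A covering theorem of Knaster-Kuratowski-Mazurkiewicz type: if closed sets `A i` cover the
standard simplex, some point lies in `A i` for every `i` in its support. -/
theorem exists_mem_of_closed_cover {I : Type*} [Fintype I] [DecidableEq I] [Nontrivial I]
    (A : I → Set (I → ℝ)) (hA : ∀ i, IsClosed (A i)) (hcover : stdSimplex ℝ I ⊆ ⋃ i, A i) :
    ∃ x ∈ stdSimplex ℝ I, ∀ i, x i = 0 ∨ x ∈ A i := by
  let q : ℕ → (I → ℕ) → I → ℝ := fun N t i => (t i : ℝ) / ((N : ℝ) + 1)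
  have hpos : ∀ N : ℕ, (0 : ℝ) < (N : ℝ) + 1 := fun N => by positivity
  have hq : ∀ N t, ∑ i, t i = N + 1 → q N t ∈ stdSimplex ℝ I := fun N t ht => by
    refine ⟨fun i => div_nonneg (Nat.cast_nonneg _) (hpos N).le, ?_⟩
    rw [← Finset.sum_div, div_eq_one_iff_eq (hpos N).ne']
    exact_mod_cast ht
  have hc : ∀ (N : ℕ) (t : I → ℕ), ∃ i, q N t ∈ stdSimplex ℝ I → q N t ∈ A i := by
    intro N t
    by_cases h : q N t ∈ stdSimplex ℝ I
    · obtain ⟨i, hi⟩ := Set.mem_iUnion.1 (hcover h)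
      exact ⟨i, fun _ => hi⟩
    · exact ⟨Classical.arbitrary I, fun h' => absurd h' h⟩
  choose c hc using hc
  choose x hx y hy hxy hcy using fun N => exists_close_rainbow (N + 1) (c N)
  obtain ⟨a, ha, φ, hφ, hlim⟩ := (isCompact_stdSimplex ℝ I).tendsto_subseq
    (x := fun N => q N (x N)) fun N => hq N _ (hx N)
  have hsmall : Tendsto (fun k => (Fintype.card I : ℝ) / ((φ k : ℝ) + 1)) atTop (𝓝 0) :=
    ((tendsto_const_div_atTop_nhds_zero_nat (Fintype.card I : ℝ)).comp
      ((tendsto_add_atTop_nat 1).comp hφ.tendsto_atTop)).congr fun k => by simp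
  have hylim : ∀ i, Tendsto (fun k => q (φ k) (y (φ k) i)) atTop (𝓝 a) := by
    intro i
    refine tendsto_pi_nhds.2 fun l => ?_
    have hxl := tendsto_pi_nhds.1 hlim l
    have hdiff : Tendsto (fun k => q (φ k) (x (φ k)) l - q (φ k) (y (φ k) i) l) atTop (𝓝 0) := by
      refine squeeze_zero_norm (fun k => ?_) hsmall
      rw [Real.norm_eq_abs, ← sub_div, abs_div, abs_of_pos (hpos _)]
      refine div_le_div_of_nonneg_right ?_ (hpos _).le
      exact_mod_cast hxy (φ k) i l
    simpa using hxl.sub hdiff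
  refine ⟨a, ha, fun i => or_iff_not_imp_left.2 fun hai => ?_⟩
  have hai' : 0 < a i := lt_of_le_of_ne (ha.1 i) (Ne.symm hai)
  refine (hA i).mem_of_tendsto (hylim i) ?_
  filter_upwards [hsmall.eventually_lt (tendsto_pi_nhds.1 (hylim i) i) hai'] with k hk
  have hk' : (Fintype.card I : ℝ) < y (φ k) i i :=
    (div_lt_div_iff_of_pos_right (hpos (φ k))).1 hk
  have hcol : c (φ k) (y (φ k) i) = i :=
    (hcy (φ k) i).resolve_right (not_le.2 (by exact_mod_cast hk'))
  have := hc (φ k) (y (φ k) i) (hq _ _ (hy (φ k) i))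
  rwa [hcol] at this

theorem mainTheorem6 (n : ℕ) (hn : 1 ≤ n) (R : ℝ) (hR : 0 < R)
    (F : (Fin n → ℝ) → (Fin n → ℝ))
    (hF : ContinuousOn F (solidSimplex n R))
    (hface : ∀ i : Fin n, ∀ x ∈ solidSimplex n R, x i = 0 → F x i < 0)
    (houter : ∀ x ∈ solidSimplex n R, ∑ i, x i = R → 0 < ∑ i, F x i) :
    ∃ x ∈ solidSimplex n R,
      F x = 0 ∧ (∀ i, 0 < x i) ∧ ∑ i, x i < R ∧ x ∈ interior (solidSimplex n R) := by
  have : Nonempty (Fin n) := ⟨⟨0, hn⟩⟩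
  -- `u` forgets the extra barycentric coordinate `1 - (∑ i, x i) / R` and rescales.
  let u : (Option (Fin n) → ℝ) → Fin n → ℝ := fun z i => R * z (some i)
  have hu : Continuous u := by fun_prop
  have husum : ∀ z ∈ stdSimplex ℝ (Option (Fin n)), ∑ i, u z i = R - R * z none := by
    intro z hz
    have := hz.2
    rw [Fintype.sum_option] at this
    rw [← Finset.mul_sum, ← mul_one_sub, ← this, add_sub_cancel_left]
  have hmaps : Set.MapsTo u (stdSimplex ℝ (Option (Fin n))) (solidSimplex n R) := fun z hz =>
    ⟨fun i => mul_nonneg hR.le (hz.1 _), by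
      rw [husum z hz]
      exact sub_le_self _ (mul_nonneg hR.le (hz.1 none))⟩
  let G : Option (Fin n) → (Option (Fin n) → ℝ) → ℝ := fun o z =>
    o.elim (-∑ i, F (u z) i) (F (u z))
  have hFu : ContinuousOn (fun z => F (u z)) (stdSimplex ℝ (Option (Fin n))) :=
    hF.comp hu.continuousOn hmaps
  have hG : ∀ o, ContinuousOn (G o) (stdSimplex ℝ (Option (Fin n))) := by
    rintro (_ | i)
    · exact (continuousOn_finsetSum _ fun i _ => continuousOn_pi.1 hFu i).neg
    · exact continuousOn_pi.1 hFu i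
  have hGsum : ∀ z, ∑ o, G o z = 0 := fun z => by
    rw [Fintype.sum_option]
    exact neg_add_cancel _
  have hGface : ∀ z ∈ stdSimplex ℝ (Option (Fin n)), ∀ o, z o = 0 → G o z < 0 := by
    rintro z hz (_ | i) h0
    · exact neg_lt_zero.2 (houter _ (hmaps hz) (by rw [husum z hz, h0, mul_zero, sub_zero]))
    · exact hface i _ (hmaps hz) (by simp only [u, h0, mul_zero])
  obtain ⟨z, hz, hzA⟩ := exists_mem_of_closed_cover
    (fun o => stdSimplex ℝ (Option (Fin n)) ∩ G o ⁻¹' Set.Iic 0)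
    (fun o => (hG o).preimage_isClosed_of_isClosed (isClosed_stdSimplex ℝ _) isClosed_Iic)
    (fun z hz => by
      obtain ⟨o, -, ho⟩ := Finset.exists_le_of_sum_le (s := Finset.univ) (f := fun o => G o z)
        (g := fun _ => 0) Finset.univ_nonempty (by simp [hGsum z])
      exact Set.mem_iUnion.2 ⟨o, hz, ho⟩)
  have hGle : ∀ o, G o z ≤ 0 := fun o => (hzA o).elim (fun h => (hGface z hz o h).le) fun h => h.2
  have hGzero : ∀ o, G o z = 0 := fun o =>
    (Finset.sum_eq_zero_iff_of_nonpos fun o _ => hGle o).1 (hGsum z) o (Finset.mem_univ o)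
  have hzpos : ∀ o, 0 < z o := fun o =>
    lt_of_le_of_ne (hz.1 o) fun h => (hGface z hz o h.symm).ne (hGzero o)
  have hupos : ∀ i, 0 < u z i := fun i => mul_pos hR (hzpos _)
  have hult : ∑ i, u z i < R := by
    rw [husum z hz]
    exact sub_lt_self _ (mul_pos hR (hzpos none))
  refine ⟨u z, hmaps hz, funext fun i => hGzero (some i), hupos, hult, ?_⟩
  have hopen : IsOpen {x : Fin n → ℝ | (∀ i, 0 < x i) ∧ ∑ i, x i < R} := by
    rw [Set.ofPred_and, Set.ofPred_forall]
    exact (isOpen_iInter_of_finite fun i => isOpen_lt continuous_const (continuous_apply i)).inter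
      (isOpen_lt (by fun_prop) continuous_const)
  exact interior_maximal (s := solidSimplex n R) (fun x hx => ⟨fun i => (hx.1 i).le, hx.2.le⟩) hopen
    ⟨hupos, hult⟩
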